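/- For $a>0$ and $\nu\in\mathbb C$ let $$K_\nu(a)=\int_0^\infty e^{-a\cosh u}\cosh(\nu u)\,du$$ be the modified Bessel function of the third kind; the integral converges absolutely. For $a>0$ and $c\in\mathbb R$ put $$F_{a,c}(z)=K_{i(z-ic)}(a)+K_{i(z+ic)}(a),\qquad z\in\mathbb C,$$ and let $$\Xi^*(z)=16\pi^2\int_0^\infty \cosh\left(\tfrac92 u\right)e^{-2\pi\cosh(2u)}\cos(zu)\,du,\qquad z\in\mathbb C,$$ be Pólya's function. Then: 1. For every $a>0$ and $c\in\mathbb R$, $F_{a,c}$ is an entire function, and for all $z\in\mathbb C$ $$F_{a,c}(z)=2\int_0^\infty\cosh(cu)\,e^{-a\cosh u}\cos(zu)\,du,$$ with an absolutely convergent integral. All zeros of $F_{a,c}$ are real. 2. The integral defining $\Xi^*(z)$ converges absolutely for all $z\in\mathbb C$, $\Xi^*$ is an entire function, and $\Xi^*(z)=4\pi^2F_{2\pi,9/4}(z/2)$ for all $z\in\mathbb C$. All zeros of $\Xi^*$ are real. -/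

import Mathlib

noncomputable section

/-- The modified Bessel function of the third kind,
`K_ν(a) = ∫_0^∞ e^{-a cosh u} cosh(ν u) du`, for real `a > 0` and complex order `ν`. -/
def besselK (ν : ℂ) (a : ℝ) : ℂ :=
  ∫ u in Set.Ioi (0 : ℝ), (Real.exp (-a * Real.cosh u) : ℂ) * Complex.cosh (ν * u)

/-- `F_{a,c}(z) = K_{i(z-ic)}(a) + K_{i(z+ic)}(a)`. -/
def polyaF (a c : ℝ) (z : ℂ) : ℂ :=
  besselK (Complex.I * (z - Complex.I * c)) a + besselK (Complex.I * (z + Complex.I * c)) a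

/-- The integrand `cosh((9/2) u) e^{-2π cosh(2u)} cos(zu)` of Pólya's function. -/
def polyaXiStarIntegrand (z : ℂ) (u : ℝ) : ℂ :=
  (Real.cosh (9 / 2 * u) : ℂ) * (Real.exp (-2 * Real.pi * Real.cosh (2 * u)) : ℂ) *
    Complex.cos (z * u)

/-- Pólya's `Ξ*(z) = 16 π² ∫_0^∞ cosh((9/2) u) e^{-2π cosh(2u)} cos(zu) du`. -/
def polyaXiStar (z : ℂ) : ℂ :=
  16 * (Real.pi : ℂ) ^ 2 * ∫ u in Set.Ioi (0 : ℝ), polyaXiStarIntegrand z u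

end

open MeasureTheory Set Filter Topology Complex

/-! With `s = iz`, a zero of `F_{a,c}` gives `K_{s+c}(a) = -K_{s-c}(a)`, hence equal moduli at two
orders with the same imaginary part. It therefore suffices that `σ ↦ |K_{σ+it}(a)|²` is even and
strictly increasing on `[0, ∞)` (`strictMonoOn_besselNormSq`): then `|Re s + c| = |Re s - c|` forces
`Re s = 0` when `c ≠ 0`, and for `c = 0` the function `K_s(a)` has no zero off the imaginary axis.

Monotonicity: the `σ`-derivative of `K_{σ+it} K_{σ-it}` is a double integral with weight `x₁ + x₂`.
Frullani's formula writes this weight as an integral over `y > 0` of exponentials that separate in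
`x₁` and `x₂` (`deriv_besselInt_mul_eq_integral`). By the scaling `besselInt_mul_right`, the inner
integral becomes `((1+y)^{2σ} - 1)` times a squared modulus, which is nonnegative for `σ > 0`.
Strictness follows from the identity theorem and the Riemann–Lebesgue lemma. -/

/-- The kernel `exp (ν x - (A eˣ + B e⁻ˣ) / 2)`. -/
noncomputable def besselKernel (A B : ℝ) (ν : ℂ) (x : ℝ) : ℂ :=
  cexp (ν * x - (((A * Real.exp x + B * Real.exp (-x)) / 2 : ℝ) : ℂ))

/-- The two-sided integral of `besselKernel`; `besselInt a a ν = 2 K_ν(a)`. -/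
noncomputable def besselInt (A B : ℝ) (ν : ℂ) : ℂ := ∫ x : ℝ, besselKernel A B ν x

/-- The derivative of `besselInt` in the order `ν`. -/
noncomputable def besselIntDeriv (A B : ℝ) (ν : ℂ) : ℂ := ∫ x : ℝ, (x : ℂ) * besselKernel A B ν x

/-! ### Convergence and holomorphy in the order. -/

lemma norm_besselKernel (A B : ℝ) (ν : ℂ) (x : ℝ) :
    ‖besselKernel A B ν x‖ =
      Real.exp (ν.re * x - (A * Real.exp x + B * Real.exp (-x)) / 2) := by
  rw [besselKernel, Complex.norm_exp]
  congr 1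
  rw [sub_re, re_mul_ofReal, ofReal_re]

@[fun_prop]
lemma continuous_besselKernel (A B : ℝ) (ν : ℂ) : Continuous (besselKernel A B ν) := by
  unfold besselKernel
  fun_prop

lemma mul_sq_le_mul_exp_add_mul_exp_neg {m A B : ℝ} (hm : 0 ≤ m) (hA : m ≤ A) (hB : m ≤ B)
    (x : ℝ) : m * x ^ 2 / 2 ≤ A * Real.exp x + B * Real.exp (-x) := by
  have h1 := Real.exp_pos x
  have h2 := Real.exp_pos (-x)
  have hA' : m * Real.exp x ≤ A * Real.exp x := by gcongr
  have hB' : m * Real.exp (-x) ≤ B * Real.exp (-x) := by gcongr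
  rcases le_total 0 x with hx | hx
  · have h := Real.quadratic_le_exp_of_nonneg hx
    have : m * (x ^ 2 / 2) ≤ m * Real.exp x := by gcongr; linarith
    have : 0 ≤ m * Real.exp (-x) := by positivity
    linarith
  · have h := Real.quadratic_le_exp_of_nonneg (neg_nonneg.2 hx)
    have : m * (x ^ 2 / 2) ≤ m * Real.exp (-x) := by gcongr; nlinarith
    have : 0 ≤ m * Real.exp x := by positivity
    linarith

lemma integrable_besselKernel {A B : ℝ} (hA : 0 < A) (hB : 0 < B) (ν : ℂ) :
    Integrable (besselKernel A B ν) := by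
  set m := min A B with hm
  have hm0 : 0 < m := lt_min hA hB
  refine ((integrable_exp_neg_mul_sq (b := m / 8) (by positivity)).const_mul
    (Real.exp (2 * ν.re ^ 2 / m))).mono' (by fun_prop) (ae_of_all _ fun x => ?_)
  rw [norm_besselKernel, ← Real.exp_add]
  apply Real.exp_le_exp.2
  have h1 := mul_sq_le_mul_exp_add_mul_exp_neg hm0.le (min_le_left A B) (min_le_right A B) x
  -- Completing the square absorbs the linear term into half of the Gaussian exponent.
  have h2 : 0 ≤ (4 * ν.re - m * x) ^ 2 / (8 * m) := by positivity
  have h3 : (4 * ν.re - m * x) ^ 2 / (8 * m) = 2 * ν.re ^ 2 / m - ν.re * x + m / 8 * x ^ 2 := by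
    field_simp
    ring
  linarith

lemma abs_le_exp_add_exp_neg (x : ℝ) : |x| ≤ Real.exp x + Real.exp (-x) := by
  have h1 := Real.add_one_le_exp x
  have h2 := Real.add_one_le_exp (-x)
  have h3 := Real.exp_pos x
  have h4 := Real.exp_pos (-x)
  rw [abs_le]
  constructor <;> linarith

lemma norm_besselKernel_add_ofReal (A B : ℝ) (ν : ℂ) (s x : ℝ) :
    ‖besselKernel A B (ν + s) x‖ = Real.exp (s * x) * ‖besselKernel A B ν x‖ := by
  rw [norm_besselKernel, norm_besselKernel, ← Real.exp_add, add_re, ofReal_re]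
  ring_nf

lemma norm_mul_besselKernel_le (A B : ℝ) (ν : ℂ) (x : ℝ) :
    ‖(x : ℂ) * besselKernel A B ν x‖ ≤
      ‖besselKernel A B (ν + (1 : ℝ)) x‖ + ‖besselKernel A B (ν + (-1 : ℝ)) x‖ := by
  rw [norm_mul, norm_real, Real.norm_eq_abs, norm_besselKernel_add_ofReal,
    norm_besselKernel_add_ofReal, ← add_mul, one_mul, neg_one_mul]
  gcongr
  exact abs_le_exp_add_exp_neg x

lemma integrable_mul_besselKernel {A B : ℝ} (hA : 0 < A) (hB : 0 < B) (ν : ℂ) :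
    Integrable (fun x : ℝ => (x : ℂ) * besselKernel A B ν x) :=
  ((integrable_besselKernel hA hB _).norm.add (integrable_besselKernel hA hB _).norm).mono'
    (by fun_prop) (ae_of_all _ fun x => norm_mul_besselKernel_le A B ν x)

lemma hasDerivAt_besselInt {A B : ℝ} (hA : 0 < A) (hB : 0 < B) (ν : ℂ) :
    HasDerivAt (besselInt A B) (besselIntDeriv A B ν) ν := by
  have hI (s : ℝ) := (integrable_besselKernel hA hB (ν + s)).norm
  refine (hasDerivAt_integral_of_dominated_loc_of_deriv_le (μ := volume)
    (F := fun w x => besselKernel A B w x)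
    (F' := fun w x => (x : ℂ) * besselKernel A B w x)
    -- This is `(eˣ + e⁻ˣ)²` times the kernel norm at `ν`: one factor bounds `|x|`, the other the
    -- change of order within the unit ball.
    (bound := fun x => ‖besselKernel A B (ν + (2 : ℝ)) x‖ + 2 * ‖besselKernel A B (ν + (0 : ℝ)) x‖
      + ‖besselKernel A B (ν + (-2 : ℝ)) x‖)
    (Metric.ball_mem_nhds ν one_pos) (Eventually.of_forall fun w => by fun_prop)
    (integrable_besselKernel hA hB ν) (by fun_prop) (ae_of_all _ fun x w hw => ?_)
    (((hI 2).add ((hI 0).const_mul 2)).add (hI (-2))) (ae_of_all _ fun x w _ => ?_)).2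
  · have hre : |w.re - ν.re| ≤ 1 := by
      rw [← sub_re]
      exact (abs_re_le_norm _).trans (mem_ball_iff_norm.1 hw).le
    have hw1 : ‖besselKernel A B w x‖ ≤
        (Real.exp x + Real.exp (-x)) * ‖besselKernel A B ν x‖ := by
      rw [norm_besselKernel, norm_besselKernel, add_mul, ← Real.exp_add, ← Real.exp_add]
      rw [abs_le] at hre
      rcases le_total 0 x with hx | hx
      · refine le_add_of_le_of_nonneg (Real.exp_le_exp.2 ?_) (Real.exp_pos _).le
        nlinarith
      · refine le_add_of_nonneg_of_le (Real.exp_pos _).le (Real.exp_le_exp.2 ?_)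
        nlinarith
    rw [norm_mul, norm_real, Real.norm_eq_abs, norm_besselKernel_add_ofReal,
      norm_besselKernel_add_ofReal, norm_besselKernel_add_ofReal]
    calc |x| * ‖besselKernel A B w x‖
        ≤ (Real.exp x + Real.exp (-x)) *
          ((Real.exp x + Real.exp (-x)) * ‖besselKernel A B ν x‖) := by
          gcongr
          exact abs_le_exp_add_exp_neg x
      _ = _ := by
          rw [show (2 : ℝ) * x = x + x by ring, show (-2 : ℝ) * x = -x + -x by ring, zero_mul,
            Real.exp_zero, Real.exp_add, Real.exp_add]
          have : Real.exp x * Real.exp (-x) = 1 := by rw [← Real.exp_add, add_neg_cancel, Real.exp_zero]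
          linear_combination 2 * ‖besselKernel A B ν x‖ * this
  · unfold besselKernel
    have h := (((hasDerivAt_id w).mul_const (x : ℂ)).sub_const
      (((A * Real.exp x + B * Real.exp (-x)) / 2 : ℝ) : ℂ)).cexp
    simpa [mul_comm] using h

lemma differentiable_besselInt {A B : ℝ} (hA : 0 < A) (hB : 0 < B) :
    Differentiable ℂ (besselInt A B) :=
  fun ν => (hasDerivAt_besselInt hA hB ν).differentiableAt

/-! ### Symmetries in the order and scaling. -/

lemma conj_besselInt (A B : ℝ) (ν : ℂ) :
    (starRingEnd ℂ) (besselInt A B ν) = besselInt A B ((starRingEnd ℂ) ν) := by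
  rw [besselInt, ← integral_conj, besselInt]
  congr 1 with x
  simp only [besselKernel, ← Complex.exp_conj, map_sub, map_mul, conj_ofReal]

lemma besselInt_neg (a : ℝ) (ν : ℂ) : besselInt a a (-ν) = besselInt a a ν := by
  rw [besselInt, besselInt, ← integral_neg_eq_self]
  congr 1 with x
  simp only [besselKernel, neg_neg]
  push_cast
  ring_nf

/-- Scaling: `∫ exp (ν x - (A eˣ + r B e⁻ˣ) / 2) dx = r ^ ν ∫ exp (ν x - (r A eˣ + B e⁻ˣ) / 2) dx`. -/
lemma besselInt_mul_right {r : ℝ} (hr : 0 < r) (A B : ℝ) (ν : ℂ) :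
    besselInt A (B * r) ν = cexp (ν * Real.log r) * besselInt (A * r) B ν := by
  rw [besselInt, besselInt, ← integral_const_mul, ← integral_add_right_eq_self _ (Real.log r)]
  congr 1 with x
  rw [besselKernel, besselKernel, ← Complex.exp_add, Real.exp_add, neg_add, Real.exp_add,
    Real.exp_neg (Real.log r), Real.exp_log hr, mul_assoc B, mul_comm r, mul_assoc (Real.exp (-x)),
    inv_mul_cancel₀ hr.ne']
  push_cast
  ring_nf

/-! ### Frullani's integral for exponentials. -/

lemma abs_inv_mul_exp_sub_exp_le {A B y : ℝ} (hy : 0 < y) :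
    |y⁻¹ * (Real.exp (-(A * y)) - Real.exp (-(B * y)))| ≤
      |B - A| * Real.exp (-(min A B * y)) := by
  wlog h : A ≤ B generalizing A B
  · rw [abs_mul, abs_sub_comm, abs_sub_comm B, min_comm, ← abs_mul]
    exact this (le_of_not_ge h)
  rw [min_eq_left h, abs_mul, abs_of_pos (inv_pos.2 hy), inv_mul_le_iff₀ hy,
    abs_of_nonneg (sub_nonneg.2 h), abs_of_nonneg (sub_nonneg.2 (Real.exp_le_exp.2 (by gcongr)))]
  have h1 : Real.exp (-(B * y)) = Real.exp (-(A * y)) * Real.exp (-((B - A) * y)) := by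
    rw [← Real.exp_add]; ring_nf
  have h2 := Real.add_one_le_exp (-((B - A) * y))
  rw [h1]
  nlinarith [Real.exp_pos (-(A * y))]

lemma integrableOn_inv_mul_exp_sub_exp {A B : ℝ} (hA : 0 < A) (hB : 0 < B) :
    IntegrableOn (fun y => y⁻¹ * (Real.exp (-(A * y)) - Real.exp (-(B * y)))) (Ioi 0) := by
  have hm := exp_neg_integrableOn_Ioi 0 (lt_min hA hB)
  refine Integrable.mono' (hm.const_mul |B - A|) (by fun_prop) ?_
  filter_upwards [self_mem_ae_restrict measurableSet_Ioi] with y hy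
  rw [Real.norm_eq_abs]
  simpa using abs_inv_mul_exp_sub_exp_le hy

lemma integral_inv_mul_exp_sub_exp {A B : ℝ} (hA : 0 < A) (hB : 0 < B) :
    ∫ y in Ioi (0 : ℝ), y⁻¹ * (Real.exp (-(A * y)) - Real.exp (-(B * y))) = Real.log (B / A) := by
  have hc : Continuous fun y : ℝ => Real.exp (-y) := by fun_prop
  have h := Frullani.integral_Ioi_eq (f := fun y : ℝ => Real.exp (-y)) (L := 1) (R := 0)
    (hc.locallyIntegrable.locallyIntegrableOn _) hA hB
    ((hc.tendsto' 0 1 (by simp)).mono_left nhdsWithin_le_nhds) Real.tendsto_exp_neg_atTop_nhds_zero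
    (integrableOn_inv_mul_exp_sub_exp hA hB)
  simpa using h

/-- The integrand has constant sign, so nothing is lost in absolute value; this yields the
integrability needed for Fubini. -/
lemma integral_norm_inv_mul_exp_sub_exp {A B : ℝ} (hA : 0 < A) (hB : 0 < B) :
    ∫ y in Ioi (0 : ℝ), ‖y⁻¹ * (Real.exp (-(A * y)) - Real.exp (-(B * y)))‖ =
      |Real.log (B / A)| := by
  wlog h : A ≤ B generalizing A B
  · rw [← abs_neg, ← Real.log_inv, inv_div, ← this hB hA (le_of_not_ge h)]
    simp only [norm_mul, norm_sub_rev]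
  rw [← integral_inv_mul_exp_sub_exp hA hB, abs_of_nonneg]
  · refine setIntegral_congr_fun measurableSet_Ioi fun y (hy : 0 < y) => ?_
    refine Real.norm_of_nonneg (mul_nonneg (inv_nonneg.2 hy.le) (sub_nonneg.2 ?_))
    gcongr
  · refine setIntegral_nonneg measurableSet_Ioi fun y (hy : 0 < y) => ?_
    refine mul_nonneg (inv_nonneg.2 hy.le) (sub_nonneg.2 ?_)
    gcongr

/-! ### Frullani representation of the derivative of a product. -/

lemma besselKernel_mul_right (a r : ℝ) (ν : ℂ) (x : ℝ) :
    besselKernel a (a * (1 + r)) ν x =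
      besselKernel a a ν x * (Real.exp (-(a * r * Real.exp (-x) / 2)) : ℝ) := by
  rw [besselKernel, besselKernel, ofReal_exp, ← Complex.exp_add]
  push_cast
  ring_nf

lemma besselKernel_mul_left (a r : ℝ) (ν : ℂ) (x : ℝ) :
    besselKernel (a * (1 + r)) a ν x =
      besselKernel a a ν x * (Real.exp (-(a * r * Real.exp x / 2)) : ℝ) := by
  rw [besselKernel, besselKernel, ofReal_exp, ← Complex.exp_add]
  push_cast
  ring_nf

/-- The quotient of the two sums is exactly `exp (x + y)`, so the weight `x + y` is a Frullani
logarithm. -/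
lemma log_exp_add_exp_div (x y : ℝ) {a : ℝ} (ha : 0 < a) :
    Real.log (a * (Real.exp x + Real.exp y) / 2 / (a * (Real.exp (-x) + Real.exp (-y)) / 2)) =
      x + y := by
  rw [show a * (Real.exp x + Real.exp y) / 2 / (a * (Real.exp (-x) + Real.exp (-y)) / 2) =
    Real.exp (x + y) by
      rw [Real.exp_neg, Real.exp_neg, Real.exp_add]
      field_simp
      ring, Real.log_exp]

/-- The integrand of the Frullani representation of the derivative of `besselInt ν * besselInt μ`. -/
noncomputable def frullaniIntegrand (a : ℝ) (ν μ : ℂ) (p : ℝ × ℝ) (y : ℝ) : ℂ :=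
  besselKernel a a ν p.1 * besselKernel a a μ p.2 *
    ((y⁻¹ * (Real.exp (-(a * (Real.exp (-p.1) + Real.exp (-p.2)) / 2 * y)) -
      Real.exp (-(a * (Real.exp p.1 + Real.exp p.2) / 2 * y))) : ℝ) : ℂ)

lemma integral_frullaniIntegrand {a : ℝ} (ha : 0 < a) (ν μ : ℂ) (p : ℝ × ℝ) :
    ∫ y in Ioi (0 : ℝ), frullaniIntegrand a ν μ p y =
      besselKernel a a ν p.1 * besselKernel a a μ p.2 * ((p.1 + p.2 : ℝ) : ℂ) := by
  unfold frullaniIntegrand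
  rw [integral_const_mul, integral_complex_ofReal, integral_inv_mul_exp_sub_exp (by positivity)
    (by positivity), log_exp_add_exp_div _ _ ha]

lemma integral_norm_frullaniIntegrand {a : ℝ} (ha : 0 < a) (ν μ : ℂ) (p : ℝ × ℝ) :
    ∫ y in Ioi (0 : ℝ), ‖frullaniIntegrand a ν μ p y‖ =
      ‖besselKernel a a ν p.1 * besselKernel a a μ p.2 * ((p.1 + p.2 : ℝ) : ℂ)‖ := by
  simp only [frullaniIntegrand, norm_mul (_ * _), norm_real]
  rw [integral_const_mul, integral_norm_inv_mul_exp_sub_exp (by positivity)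
    (by positivity), log_exp_add_exp_div _ _ ha, Real.norm_eq_abs]

lemma integrable_mul_add_besselKernel {a : ℝ} (ha : 0 < a) (ν μ : ℂ) :
    Integrable fun p : ℝ × ℝ =>
      besselKernel a a ν p.1 * besselKernel a a μ p.2 * ((p.1 + p.2 : ℝ) : ℂ) := by
  refine (((integrable_mul_besselKernel ha ha ν).mul_prod (integrable_besselKernel ha ha μ)).add
    ((integrable_besselKernel ha ha ν).mul_prod (integrable_mul_besselKernel ha ha μ))).congr
    (ae_of_all _ fun p => ?_)
  simp only [Pi.add_apply]
  push_cast
  ring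

lemma integral_mul_add_besselKernel {a : ℝ} (ha : 0 < a) (ν μ : ℂ) :
    ∫ p : ℝ × ℝ, besselKernel a a ν p.1 * besselKernel a a μ p.2 * ((p.1 + p.2 : ℝ) : ℂ) =
      besselIntDeriv a a ν * besselInt a a μ + besselInt a a ν * besselIntDeriv a a μ := by
  simp only [besselInt, besselIntDeriv]
  rw [← integral_prod_mul, ← integral_prod_mul, ← integral_add
    ((integrable_mul_besselKernel ha ha ν).mul_prod (integrable_besselKernel ha ha μ))
    ((integrable_besselKernel ha ha ν).mul_prod (integrable_mul_besselKernel ha ha μ))]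
  refine integral_congr_ae (ae_of_all _ fun p => ?_)
  push_cast
  ring

lemma integrable_frullaniIntegrand {a : ℝ} (ha : 0 < a) (ν μ : ℂ) :
    Integrable (Function.uncurry (frullaniIntegrand a ν μ))
      ((volume : Measure (ℝ × ℝ)).prod (volume.restrict (Ioi (0 : ℝ)))) := by
  have hm : Measurable (Function.uncurry (frullaniIntegrand a ν μ)) := by
    have h (ν : ℂ) := (continuous_besselKernel a a ν).measurable
    unfold Function.uncurry frullaniIntegrand
    fun_prop
  refine (integrable_prod_iff hm.aestronglyMeasurable).2 ⟨ae_of_all _ fun p => ?_, ?_⟩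
  · have h := integrableOn_inv_mul_exp_sub_exp
      (A := a * (Real.exp (-p.1) + Real.exp (-p.2)) / 2)
      (B := a * (Real.exp p.1 + Real.exp p.2) / 2) (by positivity) (by positivity)
    exact (Integrable.ofReal (𝕜 := ℂ) h).const_mul
      (besselKernel a a ν p.1 * besselKernel a a μ p.2)
  · simp only [Function.uncurry, integral_norm_frullaniIntegrand ha]
    exact (integrable_mul_add_besselKernel ha ν μ).norm

/-- For fixed `y` each exponential splits over the two variables and only rescales one coefficient
of each kernel, so the double integrals factor. -/
lemma integral_frullaniIntegrand_fst {a y : ℝ} (ha : 0 < a) (hy : 0 < y) (ν μ : ℂ) :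
    ∫ p : ℝ × ℝ, frullaniIntegrand a ν μ p y =
      (y : ℂ)⁻¹ * (besselInt a (a * (1 + y)) ν * besselInt a (a * (1 + y)) μ -
        besselInt (a * (1 + y)) a ν * besselInt (a * (1 + y)) a μ) := by
  have hb : 0 < a * (1 + y) := by positivity
  simp only [besselInt]
  rw [← integral_prod_mul, ← integral_prod_mul, ← integral_sub
    ((integrable_besselKernel ha hb ν).mul_prod (integrable_besselKernel ha hb μ))
    ((integrable_besselKernel hb ha ν).mul_prod (integrable_besselKernel hb ha μ)),
    ← integral_const_mul]
  refine integral_congr_ae (ae_of_all _ fun p => ?_)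
  have h1 : Real.exp (-(a * (Real.exp (-p.1) + Real.exp (-p.2)) / 2 * y)) =
      Real.exp (-(a * y * Real.exp (-p.1) / 2)) * Real.exp (-(a * y * Real.exp (-p.2) / 2)) := by
    rw [← Real.exp_add]
    ring_nf
  have h2 : Real.exp (-(a * (Real.exp p.1 + Real.exp p.2) / 2 * y)) =
      Real.exp (-(a * y * Real.exp p.1 / 2)) * Real.exp (-(a * y * Real.exp p.2 / 2)) := by
    rw [← Real.exp_add]
    ring_nf
  simp only [besselKernel_mul_right, besselKernel_mul_left, frullaniIntegrand, h1, h2]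
  push_cast
  ring

/-- The derivative of `K_ν(a) K_μ(a)` along `(1, 1)` as a single integral over scaled integrals. -/
theorem deriv_besselInt_mul_eq_integral {a : ℝ} (ha : 0 < a) (ν μ : ℂ) :
    besselIntDeriv a a ν * besselInt a a μ + besselInt a a ν * besselIntDeriv a a μ =
      ∫ y in Ioi (0 : ℝ), (y : ℂ)⁻¹ *
        (besselInt a (a * (1 + y)) ν * besselInt a (a * (1 + y)) μ -
          besselInt (a * (1 + y)) a ν * besselInt (a * (1 + y)) a μ) := by
  rw [← integral_mul_add_besselKernel ha]
  simp only [← integral_frullaniIntegrand ha]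
  rw [integral_integral_swap (integrable_frullaniIntegrand ha ν μ)]
  exact setIntegral_congr_fun measurableSet_Ioi fun y hy =>
    integral_frullaniIntegrand_fst ha hy ν μ

/-! ### Monotonicity of the modulus in the real part of the order. -/

/-- `|2 K_{σ + i t}(a)|²`. -/
noncomputable def besselNormSq (a t σ : ℝ) : ℝ := normSq (besselInt a a (σ + t * I))

lemma ofReal_besselNormSq (a t σ : ℝ) :
    (besselNormSq a t σ : ℂ) = besselInt a a (σ + t * I) * besselInt a a (σ - t * I) := by
  rw [besselNormSq, normSq_eq_conj_mul_self, mul_comm, conj_besselInt]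
  simp [sub_eq_add_neg]

lemma besselNormSq_neg (a t σ : ℝ) : besselNormSq a t (-σ) = besselNormSq a t σ := by
  rw [← ofReal_inj, ofReal_besselNormSq, ofReal_besselNormSq, ← besselInt_neg,
    ← besselInt_neg a (_ - _), mul_comm]
  push_cast
  ring_nf

lemma hasDerivAt_besselInt_mul {a : ℝ} (ha : 0 < a) (t : ℝ) (z : ℂ) :
    HasDerivAt (fun z => besselInt a a (z + t * I) * besselInt a a (z - t * I))
      (besselIntDeriv a a (z + t * I) * besselInt a a (z - t * I) +
        besselInt a a (z + t * I) * besselIntDeriv a a (z - t * I)) z :=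
  ((hasDerivAt_besselInt ha ha _).comp_add_const z _).mul
    ((hasDerivAt_besselInt ha ha _).comp_sub_const z _)

lemma hasDerivAt_besselNormSq {a : ℝ} (ha : 0 < a) (t σ : ℝ) :
    HasDerivAt (besselNormSq a t)
      (besselIntDeriv a a (σ + t * I) * besselInt a a (σ - t * I) +
        besselInt a a (σ + t * I) * besselIntDeriv a a (σ - t * I)).re σ := by
  have h := (hasDerivAt_besselInt_mul ha t σ).real_of_complex
  simpa only [← ofReal_besselNormSq, ofReal_re] using h

lemma besselInt_mul_conj_sub {a y : ℝ} (hy : 0 < y) (t σ : ℝ) :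
    besselInt a (a * (1 + y)) (σ + t * I) * besselInt a (a * (1 + y)) (σ - t * I) -
      besselInt (a * (1 + y)) a (σ + t * I) * besselInt (a * (1 + y)) a (σ - t * I) =
    ((Real.exp (2 * σ * Real.log (1 + y)) - 1) *
      normSq (besselInt (a * (1 + y)) a (σ + t * I)) : ℝ) := by
  have h1 : cexp (2 * σ * Real.log (1 + y)) =
      cexp ((σ + t * I) * Real.log (1 + y)) * cexp ((σ - t * I) * Real.log (1 + y)) := by
    rw [← Complex.exp_add]
    ring_nf
  rw [besselInt_mul_right (by positivity), besselInt_mul_right (by positivity), ofReal_mul,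
    normSq_eq_conj_mul_self, conj_besselInt]
  push_cast
  rw [h1]
  simp only [map_add, map_mul, conj_ofReal, conj_I]
  rw [mul_neg, ← sub_eq_add_neg]
  ring

lemma monotoneOn_besselNormSq {a : ℝ} (ha : 0 < a) (t : ℝ) :
    MonotoneOn (besselNormSq a t) (Ici 0) := by
  refine monotoneOn_of_deriv_nonneg (convex_Ici 0)
    (fun σ _ => (hasDerivAt_besselNormSq ha t σ).continuousAt.continuousWithinAt)
    (fun σ _ => (hasDerivAt_besselNormSq ha t σ).differentiableAt.differentiableWithinAt)
    fun σ hσ => ?_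
  rw [interior_Ici] at hσ
  have hσ : 0 < σ := hσ
  rw [(hasDerivAt_besselNormSq ha t σ).deriv, deriv_besselInt_mul_eq_integral ha]
  have h : ∀ y ∈ Ioi (0 : ℝ), (y : ℂ)⁻¹ *
      (besselInt a (a * (1 + y)) (σ + t * I) * besselInt a (a * (1 + y)) (σ - t * I) -
        besselInt (a * (1 + y)) a (σ + t * I) * besselInt (a * (1 + y)) a (σ - t * I)) =
      ((y⁻¹ * ((Real.exp (2 * σ * Real.log (1 + y)) - 1) *
        normSq (besselInt (a * (1 + y)) a (σ + t * I))) : ℝ) : ℂ) := fun y hy => by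
    rw [besselInt_mul_conj_sub hy, ofReal_mul (y⁻¹), ofReal_inv]
  rw [setIntegral_congr_fun measurableSet_Ioi h, integral_complex_ofReal, ofReal_re]
  refine setIntegral_nonneg measurableSet_Ioi fun y (hy : 0 < y) => ?_
  refine mul_nonneg (inv_nonneg.2 hy.le) (mul_nonneg (sub_nonneg.2 (Real.one_le_exp ?_))
    (normSq_nonneg _))
  have := Real.log_nonneg (by linarith : (1 : ℝ) ≤ 1 + y)
  positivity

/-! ### Strict monotonicity. -/

lemma Differentiable.eq_const_of_eventually_ofReal {f : ℂ → ℂ} (hf : Differentiable ℂ f) {x₀ : ℝ}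
    {C : ℂ} (h : ∀ᶠ x : ℝ in 𝓝 x₀, f x = C) (z : ℂ) : f z = C := by
  have ht : Tendsto (fun x : ℝ => (x : ℂ)) (𝓝[≠] x₀) (𝓝[≠] (x₀ : ℂ)) :=
    tendsto_nhdsWithin_iff.2 ⟨(continuous_ofReal.tendsto x₀).mono_left nhdsWithin_le_nhds,
      by filter_upwards [self_mem_nhdsWithin] with x hx using ofReal_injective.ne hx⟩
  have hfr := ht.frequently (p := fun w => f w = C)
    (h.filter_mono (nhdsWithin_le_nhds (s := {x₀}ᶜ))).frequently
  have ha : AnalyticOnNhd ℂ f univ := fun z _ => hf.analyticAt z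
  exact congrFun (ha.eq_of_frequently_eq (g := fun _ => C) analyticOnNhd_const hfr) z

/-- Along a vertical line `besselInt` is a Fourier transform, so the Riemann–Lebesgue lemma applies.
-/
lemma tendsto_besselInt_cocompact (a : ℝ) (ν : ℂ) :
    Tendsto (fun w : ℝ => besselInt a a (ν - 2 * Real.pi * w * I)) (cocompact ℝ) (𝓝 0) := by
  refine (Real.tendsto_integral_exp_smul_cocompact (besselKernel a a ν)).congr fun w => ?_
  rw [besselInt]
  congr 1 with x
  rw [Circle.smul_def, Real.fourierChar_apply, besselKernel, besselKernel, smul_eq_mul,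
    ← Complex.exp_add]
  push_cast
  ring_nf

lemma besselInt_zero_ne_zero {a : ℝ} (ha : 0 < a) : besselInt a a 0 ≠ 0 := by
  have h : besselInt a a 0 =
      ((∫ x : ℝ, Real.exp (-((a * Real.exp x + a * Real.exp (-x)) / 2)) : ℝ) : ℂ) := by
    rw [besselInt, ← integral_complex_ofReal]
    congr 1 with x
    rw [besselKernel, ofReal_exp, zero_mul, zero_sub, ofReal_neg]
  rw [h, ofReal_ne_zero]
  refine (integral_exp_pos ?_).ne'
  simpa [norm_besselKernel] using (integrable_besselKernel ha ha 0).norm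

lemma strictMonoOn_besselNormSq {a : ℝ} (ha : 0 < a) (t : ℝ) :
    StrictMonoOn (besselNormSq a t) (Ici 0) := by
  intro σ₁ h₁ σ₂ h₂ hlt
  by_contra hle
  have hmono := monotoneOn_besselNormSq ha t
  set C := besselNormSq a t σ₁ with hC
  -- A monotone function that fails to increase from `σ₁` to `σ₂` is constant between them.
  have hconst : ∀ᶠ σ : ℝ in 𝓝 ((σ₁ + σ₂) / 2),
      besselInt a a (σ + t * I) * besselInt a a (σ - t * I) = C := by
    filter_upwards [Ioo_mem_nhds (left_lt_add_div_two.2 hlt) (add_div_two_lt_right.2 hlt)] with σ hσ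
    have h0 : σ ∈ Ici (0 : ℝ) := le_trans (mem_Ici.1 h₁) hσ.1.le
    rw [← ofReal_besselNormSq, ofReal_inj]
    exact le_antisymm ((hmono h0 h₂ hσ.2.le).trans (not_lt.1 hle)) (hmono h₁ h0 hσ.1.le)
  have hdiff : Differentiable ℂ fun z => besselInt a a (z + t * I) * besselInt a a (z - t * I) :=
    fun z => (hasDerivAt_besselInt_mul ha t z).differentiableAt
  have hall := hdiff.eq_const_of_eventually_ofReal hconst
  -- The product is constant on the whole plane but decays along the imaginary axis.
  have hC0 : (C : ℂ) = 0 := by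
    have hlim := (tendsto_besselInt_cocompact a (t * I)).mul
      (tendsto_besselInt_cocompact a (-(t * I)))
    rw [mul_zero] at hlim
    refine tendsto_nhds_unique (tendsto_const_nhds.congr fun w => ?_) hlim
    rw [← hall (-(2 * Real.pi * w * I))]
    ring_nf
  have hzero (σ : ℝ) : besselInt a a (σ + t * I) = 0 := by
    have h := hall σ
    rwa [hC0, ← ofReal_besselNormSq, ofReal_eq_zero, besselNormSq, normSq_eq_zero] at h
  have hd : Differentiable ℂ fun z => besselInt a a (z + t * I) :=
    (differentiable_besselInt ha ha).comp (differentiable_id.add_const _)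
  have h := hd.eq_const_of_eventually_ofReal (x₀ := 0) (Eventually.of_forall hzero) (-(t * I))
  rw [neg_add_cancel] at h
  exact besselInt_zero_ne_zero ha h

/-! ### Location of the zeros. -/

lemma besselNormSq_abs (a t σ : ℝ) : besselNormSq a t |σ| = besselNormSq a t σ := by
  rcases abs_choice σ with h | h <;> rw [h]
  exact besselNormSq_neg a t σ

lemma besselNormSq_inj {a : ℝ} (ha : 0 < a) {t σ₁ σ₂ : ℝ} :
    besselNormSq a t σ₁ = besselNormSq a t σ₂ ↔ |σ₁| = |σ₂| := by
  rw [← besselNormSq_abs a t σ₁, ← besselNormSq_abs a t σ₂]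
  exact (strictMonoOn_besselNormSq ha t).injOn.eq_iff (abs_nonneg σ₁) (abs_nonneg σ₂)

lemma besselInt_ne_zero_of_re_ne_zero {a : ℝ} (ha : 0 < a) {ν : ℂ} (hν : ν.re ≠ 0) :
    besselInt a a ν ≠ 0 := by
  intro h
  have h1 := strictMonoOn_besselNormSq ha ν.im (mem_Ici.2 le_rfl) (abs_nonneg ν.re)
    (abs_pos.2 hν)
  rw [besselNormSq_abs, besselNormSq, besselNormSq, re_add_im, h, map_zero] at h1
  exact (normSq_nonneg _).not_gt h1

lemma re_eq_zero_of_besselInt_add_eq_zero {a : ℝ} (ha : 0 < a) {c : ℝ} {s : ℂ}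
    (h : besselInt a a (s + c) + besselInt a a (s - c) = 0) : s.re = 0 := by
  by_contra hs
  rcases eq_or_ne c 0 with rfl | hc
  · rw [ofReal_zero, add_zero, sub_zero, ← two_mul] at h
    exact besselInt_ne_zero_of_re_ne_zero ha hs
      ((mul_eq_zero.1 h).resolve_left two_ne_zero)
  · have h1 : besselNormSq a s.im (s.re + c) = besselNormSq a s.im (s.re - c) := by
      have e1 : ((s.re + c : ℝ) : ℂ) + s.im * I = s + c := by
        conv_rhs => rw [← re_add_im s]
        push_cast
        ring
      have e2 : ((s.re - c : ℝ) : ℂ) + s.im * I = s - c := by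
        conv_rhs => rw [← re_add_im s]
        push_cast
        ring
      rw [besselNormSq, besselNormSq, e1, e2, eq_neg_of_add_eq_zero_left h, normSq_neg]
    rw [besselNormSq_inj ha, ← sq_eq_sq_iff_abs_eq_abs] at h1
    have h2 : s.re * c = 0 := by linarith
    exact (mul_ne_zero hs hc) h2

/-! ### Transfer to `besselK`, `polyaF` and `polyaXiStar`. -/

lemma exp_mul_cosh_eq_besselKernel (a : ℝ) (ν : ℂ) (u : ℝ) :
    (Real.exp (-a * Real.cosh u) : ℂ) * Complex.cosh (ν * u) =
      (besselKernel a a ν u + besselKernel a a ν (-u)) / 2 := by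
  have h (x : ℝ) : besselKernel a a ν x = (Real.exp (-a * Real.cosh x) : ℂ) * cexp (ν * x) := by
    rw [besselKernel, ofReal_exp, ← Complex.exp_add, Real.cosh_eq]
    push_cast
    ring_nf
  rw [h, h, Real.cosh_neg, Complex.cosh]
  push_cast
  ring_nf

lemma integrableOn_besselK {a : ℝ} (ha : 0 < a) (ν : ℂ) :
    IntegrableOn (fun u : ℝ => (Real.exp (-a * Real.cosh u) : ℂ) * Complex.cosh (ν * u))
      (Ioi (0 : ℝ)) := by
  simp only [exp_mul_cosh_eq_besselKernel]
  have h := integrable_besselKernel ha ha ν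
  exact ((h.add h.comp_neg).div_const 2).integrableOn

lemma besselK_eq_besselInt {a : ℝ} (ha : 0 < a) (ν : ℂ) :
    besselK ν a = besselInt a a ν / 2 := by
  have h := integrable_besselKernel ha ha ν
  have h2 := integral_comp_neg_Iic (0 : ℝ) fun x => besselKernel a a ν (-x)
  simp only [neg_neg, neg_zero] at h2
  simp only [besselK, exp_mul_cosh_eq_besselKernel]
  rw [integral_div, integral_add h.integrableOn h.comp_neg.integrableOn, ← h2, besselInt,
    add_comm, intervalIntegral.integral_Iic_add_Ioi h.integrableOn h.integrableOn]

lemma polyaF_eq_besselInt {a : ℝ} (ha : 0 < a) (c : ℝ) (z : ℂ) :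
    polyaF a c z = (besselInt a a (I * z + c) + besselInt a a (I * z - c)) / 2 := by
  rw [polyaF, besselK_eq_besselInt ha, besselK_eq_besselInt ha, ← add_div,
    show I * (z - I * c) = I * z + c by linear_combination -(c : ℂ) * I_sq,
    show I * (z + I * c) = I * z - c by linear_combination (c : ℂ) * I_sq]

lemma differentiable_polyaF {a : ℝ} (ha : 0 < a) (c : ℝ) : Differentiable ℂ (polyaF a c) := by
  rw [funext (polyaF_eq_besselInt ha c)]
  have h := differentiable_besselInt ha ha
  fun_prop

lemma im_eq_zero_of_polyaF_eq_zero {a : ℝ} (ha : 0 < a) {c : ℝ} {z : ℂ}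
    (h : polyaF a c z = 0) : z.im = 0 := by
  rw [polyaF_eq_besselInt ha, div_eq_zero_iff, or_iff_left two_ne_zero] at h
  simpa using re_eq_zero_of_besselInt_add_eq_zero ha h

lemma cosh_mul_exp_mul_cos_eq (a c : ℝ) (z : ℂ) (u : ℝ) :
    (Real.cosh (c * u) : ℂ) * (Real.exp (-a * Real.cosh u) : ℂ) * Complex.cos (z * u) =
      ((Real.exp (-a * Real.cosh u) : ℂ) * Complex.cosh (I * (z - I * c) * u) +
        (Real.exp (-a * Real.cosh u) : ℂ) * Complex.cosh (I * (z + I * c) * u)) / 2 := by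
  rw [show I * (z - I * c) * u = z * u * I + c * u by linear_combination -(c : ℂ) * u * I_sq,
    show I * (z + I * c) * u = z * u * I - c * u by linear_combination (c : ℂ) * u * I_sq,
    Complex.cosh_add, Complex.cosh_sub, Complex.cosh_mul_I]
  push_cast
  ring

lemma integrableOn_polyaF {a : ℝ} (ha : 0 < a) (c : ℝ) (z : ℂ) :
    IntegrableOn (fun u : ℝ => (Real.cosh (c * u) : ℂ) * (Real.exp (-a * Real.cosh u) : ℂ) *
      Complex.cos (z * u)) (Ioi (0 : ℝ)) := by
  simp only [cosh_mul_exp_mul_cos_eq]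
  exact ((integrableOn_besselK ha _).add (integrableOn_besselK ha _)).div_const 2

lemma polyaF_eq_integral {a : ℝ} (ha : 0 < a) (c : ℝ) (z : ℂ) :
    polyaF a c z = 2 * ∫ u in Ioi (0 : ℝ), (Real.cosh (c * u) : ℂ) *
      (Real.exp (-a * Real.cosh u) : ℂ) * Complex.cos (z * u) := by
  simp only [cosh_mul_exp_mul_cos_eq]
  rw [integral_div, integral_add (integrableOn_besselK ha _) (integrableOn_besselK ha _),
    mul_div_cancel₀ _ two_ne_zero, polyaF, besselK, besselK]

/-- The substitution `v = 2u` turns `9/2` into `9/4` and `z` into `z/2`. -/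
lemma polyaXiStarIntegrand_eq (z : ℂ) :
    polyaXiStarIntegrand z = fun u => (fun v : ℝ => (Real.cosh ((9 / 4 : ℝ) * v) : ℂ) *
      (Real.exp (-(2 * Real.pi) * Real.cosh v) : ℂ) * Complex.cos (z / 2 * v)) (2 * u) := by
  ext u
  have h1 : 9 / 4 * (2 * u) = 9 / 2 * u := by ring
  have h2 : z / 2 * ((2 * u : ℝ) : ℂ) = z * u := by
    push_cast
    ring
  simp only [polyaXiStarIntegrand, h1, h2, neg_mul]

lemma integrableOn_polyaXiStarIntegrand (z : ℂ) :
    IntegrableOn (polyaXiStarIntegrand z) (Ioi (0 : ℝ)) := by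
  rw [polyaXiStarIntegrand_eq]
  refine (integrableOn_Ioi_comp_mul_left_iff (fun v : ℝ => (Real.cosh ((9 / 4 : ℝ) * v) : ℂ) *
    (Real.exp (-(2 * Real.pi) * Real.cosh v) : ℂ) * Complex.cos (z / 2 * v)) 0 two_pos).2 ?_
  rw [mul_zero]
  exact integrableOn_polyaF Real.two_pi_pos (9 / 4) (z / 2)

lemma polyaXiStar_eq_polyaF (z : ℂ) :
    polyaXiStar z = 4 * (Real.pi : ℂ) ^ 2 * polyaF (2 * Real.pi) (9 / 4) (z / 2) := by
  rw [polyaXiStar, polyaF_eq_integral Real.two_pi_pos, polyaXiStarIntegrand_eq,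
    integral_comp_mul_left_Ioi (fun v : ℝ => (Real.cosh ((9 / 4 : ℝ) * v) : ℂ) *
      (Real.exp (-(2 * Real.pi) * Real.cosh v) : ℂ) * Complex.cos (z / 2 * v)) 0 two_pos, mul_zero, real_smul]
  push_cast
  ring

theorem mainTheorem2 :
    (∀ a c : ℝ, 0 < a →
      (∀ ν : ℂ, MeasureTheory.IntegrableOn
        (fun u : ℝ => (Real.exp (-a * Real.cosh u) : ℂ) * Complex.cosh (ν * u))
        (Set.Ioi (0 : ℝ))) ∧
      Differentiable ℂ (polyaF a c) ∧
      (∀ z : ℂ,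
        MeasureTheory.IntegrableOn
          (fun u : ℝ => (Real.cosh (c * u) : ℂ) * (Real.exp (-a * Real.cosh u) : ℂ) *
            Complex.cos (z * u)) (Set.Ioi (0 : ℝ)) ∧
        polyaF a c z =
          2 * ∫ u in Set.Ioi (0 : ℝ),
            (Real.cosh (c * u) : ℂ) * (Real.exp (-a * Real.cosh u) : ℂ) *
              Complex.cos (z * u)) ∧
      (∀ z : ℂ, polyaF a c z = 0 → z.im = 0)) ∧
    (∀ z : ℂ, MeasureTheory.IntegrableOn (polyaXiStarIntegrand z) (Set.Ioi (0 : ℝ))) ∧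
    Differentiable ℂ polyaXiStar ∧
    (∀ z : ℂ, polyaXiStar z =
      4 * (Real.pi : ℂ) ^ 2 * polyaF (2 * Real.pi) (9 / 4) (z / 2)) ∧
    (∀ z : ℂ, polyaXiStar z = 0 → z.im = 0) := by
  refine ⟨fun a c ha => ⟨integrableOn_besselK ha, differentiable_polyaF ha c,
    fun z => ⟨integrableOn_polyaF ha c z, polyaF_eq_integral ha c z⟩,
    fun z => im_eq_zero_of_polyaF_eq_zero ha⟩, integrableOn_polyaXiStarIntegrand, ?_,
    polyaXiStar_eq_polyaF, fun z hz => ?_⟩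
  · rw [funext polyaXiStar_eq_polyaF]
    have h := differentiable_polyaF Real.two_pi_pos (9 / 4)
    fun_prop
  · rw [polyaXiStar_eq_polyaF] at hz
    have hpi : 4 * (Real.pi : ℂ) ^ 2 ≠ 0 := by
      simp [Real.pi_ne_zero]
    have h := im_eq_zero_of_polyaF_eq_zero Real.two_pi_pos ((mul_eq_zero.1 hz).resolve_left hpi)
    rw [show (z / 2).im = z.im / 2 by simp] at h
    linarith
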